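/- Let $$Z_1=\begin{pmatrix}0&1&0\\1&0&0\\0&0&0\end{pmatrix},\quad Z_3=\begin{pmatrix}1&0&0\\0&-1&0\\0&0&0\end{pmatrix},\quad Z_4=\begin{pmatrix}0&0&1\\0&0&0\\1&0&0\end{pmatrix},\quad Z_6=\begin{pmatrix}0&0&0\\0&0&1\\0&1&0\end{pmatrix},\quad Z_8=\tfrac1{\sqrt3}\begin{pmatrix}1&0&0\\0&1&0\\0&0&-2\end{pmatrix}$$ be the symmetric Gell-Mann matrices, and let $[A,B]=AB-BA$. Let $SO(3)$ be the fixed-point subgroup of the involution $a\mapsto (a^{-1})^{T}$ of $SU(3)$, and let $su(3)/so(3)=\{X\in su(3): X^T=X\}$ be the $(-1)$-eigenspace of its differential $X\mapsto -X^T$ on $su(3)$, where $su(3)$ is the space of anti-Hermitian $3\times3$ matrices of trace zero. The Lie triple system generated by a set $F$ of matrices is $LTS(F)=\bigcup_{p\ge1}\Theta^p$, where $\Theta^1=\operatorname{span}_{\mathbb R}F$ and $\Theta^{p+1}=\Theta^p+\operatorname{span}_{\mathbb R}\{[[A,B],C]: A,C\in\Theta^1,\ B\in\Theta^p\}$. Then: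 1. $[[Z_1,Z_3],Z_4]=2Z_6$. 2. $LTS(Z_1,Z_3,Z_4,Z_8)=\operatorname{span}_{\mathbb R}\{Z_1,Z_3,Z_4,Z_6,Z_8\}$, and likewise $LTS(iZ_1,iZ_3,iZ_4,iZ_8)=\operatorname{span}_{\mathbb R}\{iZ_1,iZ_3,iZ_4,iZ_6,iZ_8\}=su(3)/so(3)$. 3. The driftless system $$\dot x = x\,Y(u),\qquad Y(u)=i\,(Z_1u_1+Z_3u_3+Z_4u_4+Z_8u_8),\qquad u=(u_1,u_3,u_4,u_8)\in\mathbb R^4,$$ is globally controllable on $SU(3)/SO(3)$: for all $x_1,x_2\in SU(3)/SO(3)$, every representative $g\in SU(3)$ of $x_1$ and every $T>0$ there is a control $u\in L^2([0,T],\mathbb R^4)$ such that a solution $x:[0,T]\to SU(3)$ of the system with $x(0)=g$ satisfies $x(T)\,SO(3)=x_2$. 4. The system is also globally controllable on the realization $S(3)=\{A\in SU(3): A=A^T\}$ of the symmetric space, on which it induces through $A=x^Tx$ (a map whose fibres are the cosets $SO(3)x$) the system $\dot A=Y(u)^TA+A\,Y(u)$: for all $A_1,A_2\in S(3)$ and every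 $T>0$ there is a control $u\in L^2([0,T],\mathbb R^4)$ such that a solution $A:[0,T]\to S(3)$ with $A(0)=A_1$ satisfies $A(T)=A_2$. Solutions are meant in the sense of Carathéodory: continuous curves that satisfy the integrated equation. -/

import Mathlib

open MeasureTheory Set

noncomputable section

namespace COEControl

/-- Complex `3 × 3` matrices; `⁅A, B⁆ = A * B - B * A` is the commutator. -/
abbrev Mat3 : Type := Matrix (Fin 3) (Fin 3) ℂ

/-! ### The symmetric Gell-Mann matrices -/

def Z1 : Mat3 := !![0, 1, 0; 1, 0, 0; 0, 0, 0]

def Z3 : Mat3 := !![1, 0, 0; 0, -1, 0; 0, 0, 0]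

def Z4 : Mat3 := !![0, 0, 1; 0, 0, 0; 1, 0, 0]

def Z6 : Mat3 := !![0, 0, 0; 0, 0, 1; 0, 1, 0]

def Z8 : Mat3 := (1 / (Real.sqrt 3 : ℂ)) • !![1, 0, 0; 0, 1, 0; 0, 0, -2]

/-! ### Lie triple systems of matrices -/

/-- A real linear subspace that is closed under the double bracket `[[A, B], C]`,
i.e. a Lie triple subsystem of the matrix algebra. -/
def IsLieTriple (V : Submodule ℝ Mat3) : Prop :=
  ∀ A ∈ V, ∀ B ∈ V, ∀ C ∈ V, ⁅⁅A, B⁆, C⁆ ∈ V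

/-- The filtration by double brackets: `Theta F 0` is the real span of `F` and
`Theta F (p + 1) = Theta F p + span {[[A, B], C] : A, C ∈ Theta F 0, B ∈ Theta F p}`. -/
def Theta (F : Set Mat3) : ℕ → Submodule ℝ Mat3
  | 0 => Submodule.span ℝ F
  | p + 1 => Theta F p ⊔ Submodule.span ℝ
      {X | ∃ A ∈ Submodule.span ℝ F, ∃ B ∈ Theta F p, ∃ C ∈ Submodule.span ℝ F, X = ⁅⁅A, B⁆, C⁆}

/-- The Lie triple system generated by `F` under double brackets. The filtration is increasing,
so the supremum is the union. -/
def LTS (F : Set Mat3) : Submodule ℝ Mat3 := ⨆ p, Theta F p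

/-- Everything in `LTS F` lies in each Lie triple system that contains `F`. -/
theorem LTS_le {F : Set Mat3} {V : Submodule ℝ Mat3} (hF : F ⊆ V) (hV : IsLieTriple V) :
    LTS F ≤ V := by
  have h0 : Submodule.span ℝ F ≤ V := Submodule.span_le.2 hF
  refine iSup_le fun p => ?_
  induction p with
  | zero => exact h0
  | succ p ih =>
    refine sup_le ih (Submodule.span_le.2 ?_)
    rintro X ⟨A, hA, B, hB, C, hC, rfl⟩
    exact hV A (h0 hA) B (ih hB) C (h0 hC)

/-! ### `su(3)` and the Lie triple system `su(3)/so(3)` -/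

/-- `su(3)`: the anti-Hermitian matrices of trace zero, as a real vector space. -/
def su3 : Submodule ℝ Mat3 where
  carrier := {X | X.conjTranspose = -X ∧ X.trace = 0}
  add_mem' := by
    rintro X Y ⟨h1, h2⟩ ⟨h3, h4⟩
    exact ⟨by rw [Matrix.conjTranspose_add, h1, h3, neg_add], by simp [h2, h4]⟩
  zero_mem' := by simp
  smul_mem' := by
    rintro c X ⟨h1, h2⟩
    exact ⟨by rw [Matrix.conjTranspose_smul, h1]; simp, by simp [h2]⟩

/-- The Lie triple system `su(3)/so(3)`: the `-1` eigenspace in `su(3)` of the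
differential `X ↦ -Xᵀ` of the involution `a ↦ (a⁻¹)ᵀ` of `SU(3)`. -/
def su3ModSo3 : Submodule ℝ Mat3 where
  carrier := {X | X ∈ su3 ∧ -X.transpose = -X}
  add_mem' := by
    rintro X Y ⟨h1, h2⟩ ⟨h3, h4⟩
    exact ⟨su3.add_mem h1 h3, by rw [Matrix.transpose_add, neg_add, h2, h4, neg_add]⟩
  zero_mem' := ⟨su3.zero_mem, by simp⟩
  smul_mem' := by
    rintro c X ⟨h1, h2⟩
    exact ⟨su3.smul_mem c h1, by rw [Matrix.transpose_smul, neg_inj.1 h2]⟩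

/-- `su(3)/so(3)` is closed under double brackets. -/
theorem isLieTriple_su3ModSo3 : IsLieTriple su3ModSo3 := by
  rintro A ⟨⟨a1, -⟩, a2⟩ B ⟨⟨b1, -⟩, b2⟩ C ⟨⟨c1, -⟩, c2⟩
  rw [neg_inj] at a2 b2 c2
  refine ⟨⟨?_, ?_⟩, ?_⟩
  · simp only [Ring.lie_def, Matrix.conjTranspose_sub, Matrix.conjTranspose_mul, a1, b1, c1]
    noncomm_ring
  · rw [Ring.lie_def, Matrix.trace_sub, Matrix.trace_mul_comm, sub_self]
  · simp only [Ring.lie_def, Matrix.transpose_sub, Matrix.transpose_mul, a2, b2, c2]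
    noncomm_ring

/-! ### The groups `SU(3)`, `SO(3)` and the space `SU(3)/SO(3)` -/

abbrev SU3 : Type := Matrix.specialUnitaryGroup (Fin 3) ℂ

theorem coe_inv_SU3 (a : SU3) : ((a⁻¹ : SU3) : Mat3) = (a : Mat3).conjTranspose := rfl

/-- `SO(3)` as the fixed-point subgroup of the involution `a ↦ (a⁻¹)ᵀ` of `SU(3)`. -/
def SO3 : Subgroup SU3 where
  carrier := {a | ((a⁻¹ : SU3) : Mat3).transpose = (a : Mat3)}
  mul_mem' := by
    intro a b ha hb
    simp only [Set.mem_ofPred_eq] at ha hb ⊢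
    rw [mul_inv_rev, Submonoid.coe_mul, Matrix.transpose_mul, ha, hb, Submonoid.coe_mul]
  one_mem' := by simp
  inv_mem' := by
    intro a ha
    simp only [Set.mem_ofPred_eq] at ha ⊢
    rw [inv_inv, ← ha, Matrix.transpose_transpose]

/-- The elements of `SO3` are the real rotation matrices. -/
theorem mem_SO3_iff (a : SU3) :
    a ∈ SO3 ↔ ∃ O ∈ Matrix.specialOrthogonalGroup (Fin 3) ℝ,
      O.map Complex.ofRealHom = (a : Mat3) := by
  have key : a ∈ SO3 ↔ (a : Mat3).conjTranspose.transpose = (a : Mat3) := Iff.rfl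
  rw [key]
  constructor
  · intro h
    have hre : ((a : Mat3).map Complex.re).map Complex.ofRealHom = (a : Mat3) := by
      ext i j
      have := congrFun (congrFun h i) j
      simp only [Matrix.transpose_apply, Matrix.conjTranspose_apply] at this
      exact Complex.conj_eq_iff_re.1 this
    have ha := Matrix.mem_specialUnitaryGroup_iff.1 a.2
    have hinj : Function.Injective
        (Complex.ofRealHom.mapMatrix : Matrix (Fin 3) (Fin 3) ℝ →+* Mat3) := by
      intro A B hAB
      ext i j
      simpa using congrFun (congrFun hAB i) j
    refine ⟨(a : Mat3).map Complex.re, Matrix.mem_specialOrthogonalGroup_iff.2 ⟨?_, ?_⟩, hre⟩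
    · rw [Matrix.mem_orthogonalGroup_iff]
      apply hinj
      have h2 := Matrix.mem_unitaryGroup_iff.1 ha.1
      have h3 := congrArg Matrix.transpose h
      rw [Matrix.transpose_transpose] at h3
      rw [map_mul, map_one, RingHom.mapMatrix_apply, RingHom.mapMatrix_apply,
        Matrix.transpose_map, hre, ← h3]
      exact h2
    · apply Complex.ofRealHom.injective
      rw [RingHom.map_det, RingHom.mapMatrix_apply, hre, ha.2, map_one]
  · rintro ⟨O, -, h⟩
    rw [← h]
    ext i j
    simp

/-- The quotient `SU(3)/SO(3)`. -/
abbrev SU3ModSO3 : Type := SU3 ⧸ SO3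

/-- The realization of `SU(3)/SO(3)` as the set of symmetric matrices in `SU(3)`, the underlying
space of the circular orthogonal ensemble. -/
def SymmSU3 : Set Mat3 := {A | A ∈ Matrix.specialUnitaryGroup (Fin 3) ℂ ∧ A = A.transpose}

/-- The map `x ↦ xᵀ x` from `SU(3)` takes values in the symmetric matrices of `SU(3)`. -/
theorem transpose_mul_self_mem_SymmSU3 (x : SU3) :
    (x : Mat3).transpose * (x : Mat3) ∈ SymmSU3 := by
  have hx := Matrix.mem_specialUnitaryGroup_iff.1 x.2
  have h1 := Matrix.mem_unitaryGroup_iff.1 hx.1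
  have ht : (x : Mat3).transpose ∈ Matrix.specialUnitaryGroup (Fin 3) ℂ := by
    refine Matrix.mem_specialUnitaryGroup_iff.2 ⟨Matrix.mem_unitaryGroup_iff'.2 ?_, ?_⟩
    · have := congrArg Matrix.transpose h1
      rwa [Matrix.transpose_mul, Matrix.transpose_one] at this
    · rw [Matrix.det_transpose, hx.2]
  exact ⟨mul_mem ht x.2, by rw [Matrix.transpose_mul, Matrix.transpose_transpose]⟩

/-- The fibres of `x ↦ xᵀ x` are the cosets `SO(3) x`. -/
theorem transpose_mul_self_eq_iff (x y : SU3) :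
    (x : Mat3).transpose * (x : Mat3) = (y : Mat3).transpose * (y : Mat3) ↔ y * x⁻¹ ∈ SO3 := by
  have hx1 : (x : Mat3) * (x : Mat3).conjTranspose = 1 :=
    Matrix.mem_unitaryGroup_iff.1 (Matrix.mem_specialUnitaryGroup_iff.1 x.2).1
  have hx2 : (x : Mat3).conjTranspose * (x : Mat3) = 1 := mul_eq_one_comm.1 hx1
  have hy1 : (y : Mat3) * (y : Mat3).conjTranspose = 1 :=
    Matrix.mem_unitaryGroup_iff.1 (Matrix.mem_specialUnitaryGroup_iff.1 y.2).1
  have hy3 : (y : Mat3).conjTranspose.transpose * (y : Mat3).transpose = 1 := by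
    rw [← Matrix.transpose_mul, hy1, Matrix.transpose_one]
  have hy4 := mul_eq_one_comm.1 hy3
  have key : y * x⁻¹ ∈ SO3 ↔
      (y : Mat3).conjTranspose.transpose * (x : Mat3).transpose =
        (y : Mat3) * (x : Mat3).conjTranspose := by
    rw [← Matrix.transpose_mul]
    change ((((y * x⁻¹)⁻¹ : SU3) : Mat3).transpose = ((y * x⁻¹ : SU3) : Mat3)) ↔ _
    rw [mul_inv_rev, inv_inv]
    rfl
  rw [key]
  constructor
  · intro h
    calc _ = (y : Mat3).conjTranspose.transpose * ((x : Mat3).transpose * (x : Mat3)) *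
          (x : Mat3).conjTranspose := by
            rw [Matrix.mul_assoc, Matrix.mul_assoc, hx1, Matrix.mul_one]
      _ = _ := by rw [h, ← Matrix.mul_assoc, hy3, Matrix.one_mul]
  · intro h
    calc _ = (y : Mat3).transpose * ((y : Mat3).conjTranspose.transpose * (x : Mat3).transpose) *
          (x : Mat3) := by rw [← Matrix.mul_assoc, hy4, Matrix.one_mul]
      _ = _ := by rw [h, Matrix.mul_assoc, Matrix.mul_assoc, hx2, Matrix.mul_one]

/-! ### The control system -/

/-- The control values: four real controls `u₁, u₃, u₄, u₈`, with indices `0, 1, 2, 3`. -/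
abbrev Ctrl : Type := EuclideanSpace ℝ (Fin 4)

/-- The element `i (u₁ Z₁ + u₃ Z₃ + u₄ Z₄ + u₈ Z₈)` of `su(3)`. -/
def generator (u : Ctrl) : Mat3 :=
  Complex.I • (u 0 • Z1 + u 1 • Z3 + u 2 • Z4 + u 3 • Z8)

/-- `x` is on `[0, T]` a solution in `SU(3)` of `ẋ = x · generator u` (Carathéodory sense: a
continuous curve that satisfies the integral equation, entry by entry). -/
def IsSolution (T : ℝ) (u : ℝ → Ctrl) (x : ℝ → SU3) : Prop :=
  ContinuousOn x (Icc 0 T) ∧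
    ∀ t ∈ Icc 0 T, ∀ i j : Fin 3,
      (x t : Mat3) i j = (x 0 : Mat3) i j +
        ∫ s in (0 : ℝ)..t, ((x s : Mat3) * generator (u s)) i j

/-- Global controllability on the coset space `SU(3)/SO(3)`: for all points `x₁, x₂`, every
representative `g` of `x₁` and every time `T > 0` there is a square integrable control whose
trajectory starting at `g` represents `x₂` at time `T`. -/
def ControllableOnCosets : Prop :=
  ∀ (x₁ x₂ : SU3ModSO3) (g : SU3), (g : SU3ModSO3) = x₁ → ∀ T : ℝ, 0 < T →
    ∃ u : ℝ → Ctrl, MemLp u 2 (volume.restrict (Icc 0 T)) ∧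
      ∃ x : ℝ → SU3, IsSolution T u x ∧ x 0 = g ∧ ((x T : SU3) : SU3ModSO3) = x₂

/-- `A` is on `[0, T]` a solution, in the symmetric matrices of `SU(3)`, of the system
`Ȧ = (generator u)ᵀ A + A (generator u)`. For `A = xᵀ x` this is what `ẋ = x · generator u`
induces; it depends on `x` through the point `xᵀ x` only. -/
def IsSymmSolution (T : ℝ) (u : ℝ → Ctrl) (A : ℝ → Mat3) : Prop :=
  ContinuousOn A (Icc 0 T) ∧ (∀ t ∈ Icc 0 T, A t ∈ SymmSU3) ∧
    ∀ t ∈ Icc 0 T, ∀ i j : Fin 3,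
      A t i j = A 0 i j +
        ∫ s in (0 : ℝ)..t, ((generator (u s)).transpose * A s + A s * generator (u s)) i j

/-- Global controllability of the induced system on the symmetric matrices of `SU(3)`. -/
def ControllableOnSymm : Prop :=
  ∀ A₁ ∈ SymmSU3, ∀ A₂ ∈ SymmSU3, ∀ T : ℝ, 0 < T →
    ∃ u : ℝ → Ctrl, MemLp u 2 (volume.restrict (Icc 0 T)) ∧
      ∃ A : ℝ → Mat3, IsSymmSolution T u A ∧ A 0 = A₁ ∧ A T = A₂

end COEControl

end

noncomputable section

namespace COEControl

/-! ### The generated Lie triple systems -/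

/-! The Lie triple systems: the matrices iZ₁, iZ₃, iZ₄, iZ₆, iZ₈ are a basis of `su3ModSo3`, which
is closed under double brackets and so bounds the generated system from above. The only missing
generator is iZ₆, and the bracket of Z₁, Z₃, Z₄ supplies it. Since i³ = -i, multiplication by i
carries closure under double brackets over to the Z's.

Controllability is proved without an orbit theorem, and in a stronger form: every element of SU(3)
is reached from 1 (`reachable`). Reachable points are closed under products and contain the
one-parameter subgroups of the control directions. Z₁ and Z₃ yield the SU(2) on coordinates 1, 2
through Euler angles; Z₄ and diag(1, 0, -1), a combination of Z₃ and Z₈, yield the one on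
coordinates 1, 3. Two Givens rotations from these subgroups bring any g into the stabilizer of the
first basis vector, which is conjugate to the first SU(2) by an element of the second.

Left invariance moves the starting point from 1 to any g, which gives the coset statement. For
symmetric matrices both endpoints are lifted along x ↦ xᵀx, surjective because a symmetric unitary
matrix has a square root that is a polynomial in it, hence again symmetric. -/

theorem bracket_Z1_Z3_Z4 : ⁅⁅Z1, Z3⁆, Z4⁆ = (2 : ℂ) • Z6 := by
  ext i j
  fin_cases i <;> fin_cases j <;>
    simp [Ring.lie_def, Z1, Z3, Z4, Z6] <;> norm_num

theorem mem_LTS_of_mem {F : Set Mat3} {X : Mat3} (hX : X ∈ F) : X ∈ LTS F :=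
  le_iSup (Theta F) 0 (Submodule.subset_span hX)

theorem bracket_mem_LTS {F : Set Mat3} {A B C : Mat3} (hA : A ∈ F) (hB : B ∈ F) (hC : C ∈ F) :
    ⁅⁅A, B⁆, C⁆ ∈ LTS F :=
  le_iSup (Theta F) 1 (le_sup_right (a := Theta F 0) (Submodule.subset_span
    ⟨A, Submodule.subset_span hA, B, Submodule.subset_span hB, C, Submodule.subset_span hC, rfl⟩))

/-- Multiplication by `i` as a real linear map. -/
def mulI : Mat3 →ₗ[ℝ] Mat3 where
  toFun X := Complex.I • X
  map_add' := smul_add _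
  map_smul' c X := smul_comm _ c X

theorem mulI_apply (X : Mat3) : mulI X = Complex.I • X := rfl

theorem mulI_injective : Function.Injective mulI :=
  smul_right_injective _ Complex.I_ne_zero

theorem bracket_mulI (A B C : Mat3) :
    ⁅⁅mulI A, mulI B⁆, mulI C⁆ = -mulI ⁅⁅A, B⁆, C⁆ := by
  have h : Complex.I * (Complex.I * Complex.I) = -Complex.I := by simp
  simp only [mulI_apply, Ring.lie_def, smul_mul_assoc, mul_smul_comm, smul_smul, ← smul_sub,
    mul_assoc, h, neg_smul]
  rw [smul_sub, neg_sub_neg, neg_sub]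

/-- The `i`-multiples of the symmetric Gell-Mann matrices span `su(3)/so(3)`. -/
theorem span_mulI_Z :
    Submodule.span ℝ {mulI Z1, mulI Z3, mulI Z4, mulI Z6, mulI Z8} = su3ModSo3 := by
  have h3 : (Real.sqrt 3 : ℂ) ≠ 0 := by
    exact_mod_cast (Real.sqrt_pos.2 (by norm_num : (0 : ℝ) < 3)).ne'
  apply le_antisymm
  · refine Submodule.span_le.2 ?_
    rintro X (rfl | rfl | rfl | rfl | rfl) <;> refine ⟨⟨?_, ?_⟩, ?_⟩
    all_goals
      try (ext i j; fin_cases i <;> fin_cases j)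
      all_goals simp [mulI_apply, Z1, Z3, Z4, Z6, Z8, Matrix.trace, Fin.sum_univ_three]
    all_goals ring
  · rintro X ⟨⟨hX, htr⟩, hs⟩
    have hsym : ∀ i j, X j i = X i j := fun i j => by
      simpa using congrFun (congrFun hs i) j
    have hre : ∀ i j, (X i j).re = 0 := fun i j => by
      have h := congrArg Complex.re (congrFun (congrFun hX j) i)
      simp only [Matrix.conjTranspose_apply, Matrix.neg_apply, hsym, Complex.star_def,
        Complex.conj_re, Complex.neg_re] at h
      linarith
    have him : ∀ i j, X i j = Complex.I * ((X i j).im : ℂ) := fun i j => by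
      apply Complex.ext <;> simp [hre]
    have htr' : (X 2 2).im = -(X 0 0).im - (X 1 1).im := by
      have := congrArg Complex.im htr
      simp [Matrix.trace, Fin.sum_univ_three] at this
      linarith
    -- A traceless diagonal (x, y, -x-y) is (x-y)/2 · Z₃ + √3(x+y)/2 · Z₈.
    have key : X = (X 0 1).im • mulI Z1 + (((X 0 0).im - (X 1 1).im) / 2) • mulI Z3 +
        (X 0 2).im • mulI Z4 + (X 1 2).im • mulI Z6 +
        (Real.sqrt 3 * ((X 0 0).im + (X 1 1).im) / 2) • mulI Z8 := by
      ext i j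
      rw [him i j]
      fin_cases i <;> fin_cases j <;>
        simp [mulI_apply, Z1, Z3, Z4, Z6, Z8, htr', hsym 0 1, hsym 0 2, hsym 1 2] <;>
        field_simp <;> ring
    rw [key]
    have hm : ∀ Y ∈ ({mulI Z1, mulI Z3, mulI Z4, mulI Z6, mulI Z8} : Set Mat3), ∀ c : ℝ,
        c • Y ∈ Submodule.span ℝ ({mulI Z1, mulI Z3, mulI Z4, mulI Z6, mulI Z8} : Set Mat3) :=
      fun Y hY c => Submodule.smul_mem _ _ (Submodule.subset_span hY)
    exact add_mem (add_mem (add_mem (add_mem (hm _ (by simp) _) (hm _ (by simp) _))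
      (hm _ (by simp) _)) (hm _ (by simp) _)) (hm _ (by simp) _)

theorem LTS_mulI_Z : LTS {mulI Z1, mulI Z3, mulI Z4, mulI Z8} = su3ModSo3 := by
  apply le_antisymm
  · refine LTS_le ?_ isLieTriple_su3ModSo3
    rw [← span_mulI_Z]
    refine subset_trans ?_ Submodule.subset_span
    rintro X (rfl | rfl | rfl | rfl) <;> simp
  · rw [← span_mulI_Z]
    refine Submodule.span_le.2 ?_
    have h6 : mulI Z6 ∈ LTS {mulI Z1, mulI Z3, mulI Z4, mulI Z8} := by
      have h := bracket_mem_LTS (F := {mulI Z1, mulI Z3, mulI Z4, mulI Z8})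
        (A := mulI Z1) (B := mulI Z3) (C := mulI Z4) (by simp) (by simp) (by simp)
      have h2 : (2 : ℂ) • Z6 = (2 : ℝ) • Z6 := by rw [two_smul, two_smul]
      rw [bracket_mulI, bracket_Z1_Z3_Z4, h2, map_smul] at h
      simpa using Submodule.smul_mem _ (-(1 / 2) : ℝ) h
    rintro X (rfl | rfl | rfl | rfl | rfl)
    · exact mem_LTS_of_mem (by simp)
    · exact mem_LTS_of_mem (by simp)
    · exact mem_LTS_of_mem (by simp)
    · exact h6
    · exact mem_LTS_of_mem (by simp)

theorem span_Z : Submodule.span ℝ {Z1, Z3, Z4, Z6, Z8} = su3ModSo3.comap mulI := by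
  rw [← span_mulI_Z]
  have : ({mulI Z1, mulI Z3, mulI Z4, mulI Z6, mulI Z8} : Set Mat3) =
      mulI '' {Z1, Z3, Z4, Z6, Z8} := by simp only [image_insert_eq, image_singleton]
  rw [this, ← Submodule.map_span, Submodule.comap_map_eq_of_injective mulI_injective]

theorem isLieTriple_span_Z : IsLieTriple (Submodule.span ℝ {Z1, Z3, Z4, Z6, Z8}) := by
  rw [span_Z]
  intro A hA B hB C hC
  have h := isLieTriple_su3ModSo3 _ hA _ hB _ hC
  rw [bracket_mulI] at h
  exact su3ModSo3.neg_mem_iff.1 h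

theorem LTS_Z : LTS {Z1, Z3, Z4, Z8} = Submodule.span ℝ {Z1, Z3, Z4, Z6, Z8} := by
  apply le_antisymm
  · refine LTS_le ?_ isLieTriple_span_Z
    refine subset_trans ?_ Submodule.subset_span
    rintro X (rfl | rfl | rfl | rfl) <;> simp
  · refine Submodule.span_le.2 ?_
    have h6 : Z6 ∈ LTS {Z1, Z3, Z4, Z8} := by
      have h := bracket_mem_LTS (F := {Z1, Z3, Z4, Z8})
        (A := Z1) (B := Z3) (C := Z4) (by simp) (by simp) (by simp)
      have h2 : (2 : ℂ) • Z6 = (2 : ℝ) • Z6 := by rw [two_smul, two_smul]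
      rw [bracket_Z1_Z3_Z4, h2] at h
      simpa using Submodule.smul_mem _ (1 / 2 : ℝ) h
    rintro X (rfl | rfl | rfl | rfl | rfl)
    · exact mem_LTS_of_mem (by simp)
    · exact mem_LTS_of_mem (by simp)
    · exact mem_LTS_of_mem (by simp)
    · exact h6
    · exact mem_LTS_of_mem (by simp)

/-! ### Symmetric unitary matrices as `xᵀ x` -/

open scoped Matrix.Norms.L2Operator in
/-- A unitary matrix has a unitary square root that is a polynomial in it. -/
theorem exists_aeval_sq_eq_of_mem_unitary {n : Type*} [Fintype n] [DecidableEq n]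
    {A : Matrix n n ℂ} (h : A ∈ Matrix.unitaryGroup n ℂ) :
    ∃ p : Polynomial ℂ, (Polynomial.aeval A p) ^ 2 = A ∧
      Polynomial.aeval A p ∈ Matrix.unitaryGroup n ℂ := by
  have : IsStarNormal A := isStarNormal_of_mem_unitary h
  have hfin : (spectrum ℂ A).Finite := Matrix.finite_spectrum A
  -- `f` need not be continuous: the spectrum is finite, so a polynomial interpolates `f` there, and
  -- the functional calculus sees only values on the spectrum.
  choose f hf using fun z : ℂ => IsAlgClosed.exists_pow_nat_eq z (n := 2) two_pos
  have hp : ∀ z ∈ spectrum ℂ A,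
      (Lagrange.interpolate hfin.toFinset id f).eval z = f z := fun z hz =>
    Lagrange.eval_interpolate_at_node (v := id) f (Function.injective_id.injOn)
      (hfin.mem_toFinset.2 hz)
  refine ⟨Lagrange.interpolate hfin.toFinset id f, ?_, ?_⟩
  · rw [← map_pow, ← cfc_polynomial _ A]
    refine Eq.trans ?_ (cfc_eval_X (R := ℂ) A)
    refine cfc_congr fun z hz => ?_
    simp only [Polynomial.eval_pow, hp z hz, hf, Polynomial.eval_X]
  · rw [Matrix.mem_unitaryGroup_iff', ← cfc_polynomial _ A, ← cfc_star, ← cfc_mul _ _ A,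
      ← cfc_one ℂ A]
    refine cfc_congr fun z hz => ?_
    have hz1 : ‖f z‖ = 1 := by
      have h1 := congrArg norm (hf z)
      rw [norm_pow, spectrum.norm_eq_one_of_unitary h hz] at h1
      exact (pow_eq_one_iff_of_nonneg (norm_nonneg _) two_ne_zero).1 h1
    simp only [hp z hz, Complex.star_def, Pi.one_apply]
    rw [← Complex.normSq_eq_conj_mul_self, Complex.normSq_eq_norm_sq, hz1]
    simp

theorem transpose_aeval {n : Type*} [Fintype n] [DecidableEq n] (A : Matrix n n ℂ)
    (p : Polynomial ℂ) :
    (Polynomial.aeval A p).transpose = Polynomial.aeval A.transpose p := by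
  simp [Polynomial.aeval_eq_sum_range, Matrix.transpose_sum, Matrix.transpose_pow]

/-- `x ↦ xᵀ x` maps `SU(3)` onto its symmetric matrices. -/
theorem exists_transpose_mul_self_eq {A : Mat3} (hA : A ∈ SymmSU3) :
    ∃ x : SU3, (x : Mat3).transpose * (x : Mat3) = A := by
  obtain ⟨hA, hsym⟩ := hA
  obtain ⟨hU, hdet⟩ := Matrix.mem_specialUnitaryGroup_iff.1 hA
  obtain ⟨p, hp, hpU⟩ := exists_aeval_sq_eq_of_mem_unitary hU
  set B := Polynomial.aeval A p with hB
  have hBt : B.transpose = B := by rw [hB, transpose_aeval, ← hsym]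
  have hBdet : B.det = 1 ∨ B.det = -1 := by
    rw [← sq_eq_one_iff, ← Matrix.det_pow, hp, hdet]
  rcases hBdet with h | h
  · exact ⟨⟨B, Matrix.mem_specialUnitaryGroup_iff.2 ⟨hpU, h⟩⟩, by rw [hBt, ← sq, hp]⟩
  -- In odd dimension a sign change turns determinant -1 into 1, and it keeps the square.
  · refine ⟨⟨-B, Matrix.mem_specialUnitaryGroup_iff.2 ⟨?_, ?_⟩⟩, ?_⟩
    · rw [Matrix.mem_unitaryGroup_iff] at hpU ⊢
      simpa using hpU
    · simp [Matrix.det_neg, h]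
      norm_num
    · simp [hBt, ← sq, hp]

/-! ### Steering by continuous controls -/

/-- `g` is reached from `1` in each time interval, by a continuous control that vanishes
outside the interval. -/
def Reachable (g : SU3) : Prop :=
  ∀ a b : ℝ, a < b → ∃ u : ℝ → Ctrl, Continuous u ∧ (∀ t, t ≤ a → u t = 0) ∧
    (∀ t, b ≤ t → u t = 0) ∧ ∃ x : ℝ → SU3, (∀ t, t ≤ a → x t = 1) ∧ (∀ t, b ≤ t → x t = g) ∧
      ∀ t i j, HasDerivAt (fun s => (x s : Mat3) i j) (((x t : Mat3) * generator (u t)) i j) t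

theorem generator_add (u v : Ctrl) : generator (u + v) = generator u + generator v := by
  simp only [generator, PiLp.add_apply, add_smul, ← smul_add]
  congr 1
  abel

theorem generator_smul (c : ℝ) (u : Ctrl) : generator (c • u) = c • generator u := by
  simp only [generator, PiLp.smul_apply, smul_eq_mul, mul_smul, ← smul_add, smul_comm Complex.I c]

theorem generator_zero : generator 0 = 0 := by
  simpa using generator_smul 0 0

theorem continuous_generator : Continuous generator := by
  unfold generator
  fun_prop

theorem hasDerivAt_matrix_mul {X Y : ℝ → Mat3} {X' Y' : Mat3} {t : ℝ}
    (hX : ∀ i j, HasDerivAt (fun s => X s i j) (X' i j) t)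
    (hY : ∀ i j, HasDerivAt (fun s => Y s i j) (Y' i j) t) (i j : Fin 3) :
    HasDerivAt (fun s => (X s * Y s) i j) ((X' * Y t + X t * Y') i j) t := by
  simp only [Matrix.mul_apply, Matrix.add_apply, ← Finset.sum_add_distrib]
  exact HasDerivAt.fun_sum fun k _ => (hX i k).mul (hY k j)

/-- Concatenation of trajectories, written as the pointwise product of two curves that move on
successive time intervals. -/
theorem Reachable.mul {g h : SU3} (hg : Reachable g) (hh : Reachable h) : Reachable (g * h) := by
  intro a b hab
  obtain ⟨c, hac, hcb⟩ := exists_between hab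
  obtain ⟨u, hu, hua, hub, x, hxa, hxb, hx⟩ := hg a c hac
  obtain ⟨v, hv, hva, hvb, y, hya, hyb, hy⟩ := hh c b hcb
  refine ⟨fun t => u t + v t, hu.add hv, fun t ht => ?_, fun t ht => ?_, fun t => x t * y t,
    fun t ht => ?_, fun t ht => ?_, fun t i j => ?_⟩
  · simp [hua t ht, hva t (ht.trans hac.le)]
  · simp [hub t (hcb.le.trans ht), hvb t ht]
  · simp [hxa t ht, hya t (ht.trans hac.le)]
  · simp [hxb t (hcb.le.trans ht), hyb t ht]
  -- Before `c` the second curve is still 1, after `c` the first control is 0; so the generator of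
  -- the first moves past `y t`.
  · have hcomm : generator (u t) * (y t : Mat3) = (y t : Mat3) * generator (u t) := by
      rcases le_total t c with ht | ht
      · simp [hya t ht]
      · simp [hub t ht, generator_zero]
    have h := hasDerivAt_matrix_mul (hx t) (hy t) i j
    have e : (x t : Mat3) * generator (u t) * (y t : Mat3) +
        (x t : Mat3) * ((y t : Mat3) * generator (v t)) =
        ((x t * y t : SU3) : Mat3) * generator (u t + v t) := by
      rw [generator_add, Submonoid.coe_mul, mul_assoc, hcomm, mul_add, mul_assoc, mul_assoc]
    rw [e] at h
    exact h

/-- The points of a one-parameter subgroup with generator in the control space are reachable. -/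
theorem reachable_of_hasDerivAt {γ : ℝ → SU3} {v : Ctrl} (h0 : γ 0 = 1)
    (hγ : ∀ s i j, HasDerivAt (fun s => (γ s : Mat3) i j) (((γ s : Mat3) * generator v) i j) s)
    (s : ℝ) : Reachable (γ s) := by
  intro a b hab
  have hba : 0 < b - a := sub_pos.2 hab
  -- A smooth step from 0 at `a` to 1 at `b`: the curve γ(s φ(t)) then has the continuous control s
  -- φ'(t) v.
  set φ : ℝ → ℝ := fun t => Real.smoothTransition ((t - a) / (b - a)) with hφ
  have hφs : ContDiff ℝ 1 φ := Real.smoothTransition.contDiff.comp (by fun_prop)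
  have hd : ∀ t, HasDerivAt φ (deriv φ t) t := fun t =>
    ((hφs.differentiable one_ne_zero) t).hasDerivAt
  have hφa : ∀ t, t ≤ a → φ t = 0 := fun t ht =>
    Real.smoothTransition.zero_of_nonpos (div_nonpos_of_nonpos_of_nonneg (by linarith) hba.le)
  have hφb : ∀ t, b ≤ t → φ t = 1 := fun t ht =>
    Real.smoothTransition.one_of_one_le ((one_le_div hba).2 (by linarith))
  refine ⟨fun t => (s * deriv φ t) • v,
    (continuous_const.mul (hφs.continuous_deriv le_rfl)).smul continuous_const,
    fun t ht => ?_, fun t ht => ?_, fun t => γ (s * φ t), fun t ht => ?_, fun t ht => ?_,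
    fun t i j => ?_⟩
  -- φ attains its global minimum 0 here, endpoint `a` included; the next case uses the maximum 1.
  · have : deriv φ t = 0 := IsLocalMin.deriv_eq_zero (Filter.Eventually.of_forall fun r => by
      rw [hφa t ht]; exact Real.smoothTransition.nonneg _)
    simp [this]
  · have : deriv φ t = 0 := IsLocalMax.deriv_eq_zero (Filter.Eventually.of_forall fun r => by
      rw [hφb t ht]; exact Real.smoothTransition.le_one _)
    simp [this]
  · simp [hφa t ht, h0]
  · simp [hφb t ht]
  · have h := (hγ (s * φ t) i j).scomp t ((hd t).const_mul s)
    rw [generator_smul, Matrix.mul_smul]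
    exact h

/-! ### Trajectories with continuous controls -/

theorem memLp_of_continuous {u : ℝ → Ctrl} (hu : Continuous u) (T : ℝ) :
    MemLp u 2 (volume.restrict (Icc 0 T)) := by
  obtain ⟨C, hC⟩ := isCompact_Icc.exists_bound_of_continuousOn (s := Icc (0 : ℝ) T) hu.continuousOn
  exact MemLp.of_bound hu.aestronglyMeasurable C
    ((ae_restrict_iff' measurableSet_Icc).2 (Filter.Eventually.of_forall hC))

theorem continuous_of_hasDerivAt_entries {X : ℝ → Mat3} {X' : ℝ → Mat3}
    (h : ∀ t i j, HasDerivAt (fun s => X s i j) (X' t i j) t) : Continuous X :=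
  continuous_pi fun i => continuous_pi fun j =>
    continuous_iff_continuousAt.2 fun t => (h t i j).continuousAt

theorem entry_eq_add_integral {X : ℝ → Mat3} {X' : ℝ → Mat3}
    (h : ∀ t i j, HasDerivAt (fun s => X s i j) (X' t i j) t) (hc : Continuous X') (t : ℝ)
    (i j : Fin 3) : X t i j = X 0 i j + ∫ s in (0 : ℝ)..t, X' s i j := by
  rw [intervalIntegral.integral_eq_sub_of_hasDerivAt (f := fun s => X s i j)
    (fun s _ => h s i j) (hc.matrix_elem i j |>.intervalIntegrable _ _)]
  ring

/-- The system is left invariant: g times a trajectory is a trajectory with the same control. -/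
theorem Reachable.exists_isSolution {h : SU3} (hh : Reachable h) (g : SU3) {T : ℝ} (hT : 0 < T) :
    ∃ u : ℝ → Ctrl, MemLp u 2 (volume.restrict (Icc 0 T)) ∧
      ∃ x : ℝ → SU3, IsSolution T u x ∧ x 0 = g ∧ x T = g * h := by
  obtain ⟨u, hu, -, -, x, hx0, hxT, hx⟩ := hh 0 T hT
  have hd : ∀ t i j, HasDerivAt (fun s => ((g * x s : SU3) : Mat3) i j)
      ((((g * x t : SU3) : Mat3) * generator (u t)) i j) t := fun t i j => by
    have := hasDerivAt_matrix_mul (X := fun _ => (g : Mat3)) (X' := 0)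
      (fun i j => hasDerivAt_const t _) (hx t) i j
    rwa [zero_mul, zero_add, ← mul_assoc] at this
  have hcx := continuous_of_hasDerivAt_entries hd
  refine ⟨u, memLp_of_continuous hu T, fun t => g * x t, ⟨?_, fun t _ i j => ?_⟩, ?_, ?_⟩
  · exact (hcx.subtype_mk fun t => (g * x t).2).continuousOn
  · exact entry_eq_add_integral hd (hcx.mul (continuous_generator.comp hu)) t i j
  · simp [hx0 0 le_rfl]
  · simp [hxT T le_rfl]

theorem Reachable.exists_isSymmSolution {h : SU3} (hh : Reachable h) (g : SU3) {T : ℝ}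
    (hT : 0 < T) :
    ∃ u : ℝ → Ctrl, MemLp u 2 (volume.restrict (Icc 0 T)) ∧
      ∃ A : ℝ → Mat3, IsSymmSolution T u A ∧ A 0 = (g : Mat3).transpose * (g : Mat3) ∧
        A T = ((g * h : SU3) : Mat3).transpose * ((g * h : SU3) : Mat3) := by
  obtain ⟨u, hu, -, -, x, hx0, hxT, hx⟩ := hh 0 T hT
  have hd : ∀ t i j, HasDerivAt (fun s => ((g * x s : SU3) : Mat3) i j)
      ((((g * x t : SU3) : Mat3) * generator (u t)) i j) t := fun t i j => by
    have := hasDerivAt_matrix_mul (X := fun _ => (g : Mat3)) (X' := 0)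
      (fun i j => hasDerivAt_const t _) (hx t) i j
    rwa [zero_mul, zero_add, ← mul_assoc] at this
  set A : ℝ → Mat3 := fun t => ((g * x t : SU3) : Mat3).transpose * ((g * x t : SU3) : Mat3)
  have hdA : ∀ t i j, HasDerivAt (fun s => A s i j)
      (((generator (u t)).transpose * A t + A t * generator (u t)) i j) t := fun t i j => by
    have h := hasDerivAt_matrix_mul
      (X := fun s => ((g * x s : SU3) : Mat3).transpose)
      (X' := (((g * x t : SU3) : Mat3) * generator (u t)).transpose)
      (fun i j => hd t j i) (hd t) i j
    rw [Matrix.transpose_mul, mul_assoc, ← mul_assoc _ _ (generator (u t))] at h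
    exact h
  have hcA := continuous_of_hasDerivAt_entries hdA
  have hcu := continuous_generator.comp hu
  refine ⟨u, memLp_of_continuous hu T, A, ⟨hcA.continuousOn,
    fun t _ => transpose_mul_self_mem_SymmSU3 _, fun t _ i j => ?_⟩, ?_, ?_⟩
  · exact entry_eq_add_integral hdA
      ((hcu.matrix_transpose.mul hcA).add (hcA.mul hcu)) t i j
  · simp [A, hx0 0 le_rfl]
  · simp [A, hxT T le_rfl]

/-! ### Generation of `SU(3)` by the control directions -/

/-- The elements that are reachable together with their inverses. -/
def reachableSubgroup : Subgroup SU3 where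
  carrier := {g | Reachable g ∧ Reachable g⁻¹}
  mul_mem' := fun hg hh => ⟨hg.1.mul hh.1, by rw [mul_inv_rev]; exact hh.2.mul hg.2⟩
  one_mem' := by
    have : Reachable (1 : SU3) := reachable_of_hasDerivAt (γ := fun _ => 1) (v := 0) rfl
      (fun s i j => by rw [generator_zero]; simpa using hasDerivAt_const s _) 0
    exact ⟨this, by rwa [inv_one]⟩
  inv_mem' := fun hg => ⟨hg.2, by rw [inv_inv]; exact hg.1⟩

/-- For unitary matrices `hγs` says that γ(-s) is the inverse of γ(s), so the inverse lies on the
same curve. -/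
theorem mem_reachableSubgroup_of_hasDerivAt {γ : ℝ → Mat3} {v : Ctrl} (h0 : γ 0 = 1)
    (hγm : ∀ s, γ s ∈ Matrix.specialUnitaryGroup (Fin 3) ℂ)
    (hγs : ∀ s, (γ s).conjTranspose = γ (-s))
    (hγ : ∀ s i j, HasDerivAt (fun s => γ s i j) ((γ s * generator v) i j) s) (s : ℝ) :
    (⟨γ s, hγm s⟩ : SU3) ∈ reachableSubgroup := by
  have h : ∀ s, Reachable (⟨γ s, hγm s⟩ : SU3) := reachable_of_hasDerivAt
    (γ := fun s => ⟨γ s, hγm s⟩) (Subtype.ext h0) hγ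
  refine ⟨h s, ?_⟩
  have e : (⟨γ s, hγm s⟩ : SU3)⁻¹ = ⟨γ (-s), hγm (-s)⟩ := Subtype.ext (by
    rw [coe_inv_SU3]; exact hγs s)
  rw [e]
  exact h (-s)

theorem mem_SU3_iff (A : Mat3) :
    A ∈ Matrix.specialUnitaryGroup (Fin 3) ℂ ↔ A * A.conjTranspose = 1 ∧ A.det = 1 := by
  rw [Matrix.mem_specialUnitaryGroup_iff, Matrix.mem_unitaryGroup_iff]
  rfl

/-! ### Two embedded copies of SU(2) -/

open ComplexConjugate

/-- The matrix `(a, -b̄; b, ā)` acting on the coordinates `1, 2`. -/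
def block12 (a b : ℂ) : Mat3 := !![a, -conj b, 0; b, conj a, 0; 0, 0, 1]

/-- The matrix `(a, -b̄; b, ā)` acting on the coordinates `1, 3`. -/
def block13 (a b : ℂ) : Mat3 := !![a, 0, -conj b; 0, 1, 0; b, 0, conj a]

/-- Matrices of the quaternion form (a, -b̄; b, ā) are closed under multiplication, so the product
is read off its first column. -/
theorem block12_mul (a b c d : ℂ) :
    block12 a b * block12 c d = block12 (a * c - conj b * d) (b * c + conj a * d) := by
  ext i j
  fin_cases i <;> fin_cases j <;>
    simp [block12, Matrix.mul_apply, Fin.sum_univ_three] <;> ring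

theorem block13_mul (a b c d : ℂ) :
    block13 a b * block13 c d = block13 (a * c - conj b * d) (b * c + conj a * d) := by
  ext i j
  fin_cases i <;> fin_cases j <;>
    simp [block13, Matrix.mul_apply, Fin.sum_univ_three] <;> ring

theorem conjTranspose_block12 (a b : ℂ) :
    (block12 a b).conjTranspose = block12 (conj a) (-b) := by
  ext i j
  fin_cases i <;> fin_cases j <;> simp [block12]

theorem conjTranspose_block13 (a b : ℂ) :
    (block13 a b).conjTranspose = block13 (conj a) (-b) := by
  ext i j
  fin_cases i <;> fin_cases j <;> simp [block13]

theorem block12_one : block12 1 0 = 1 := by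
  ext i j
  fin_cases i <;> fin_cases j <;> simp [block12]

theorem block13_one : block13 1 0 = 1 := by
  ext i j
  fin_cases i <;> fin_cases j <;> simp [block13]

theorem block12_mem {a b : ℂ} (h : a * conj a + b * conj b = 1) :
    block12 a b ∈ Matrix.specialUnitaryGroup (Fin 3) ℂ := by
  rw [mem_SU3_iff]
  constructor
  · rw [conjTranspose_block12, block12_mul, ← block12_one]
    congr 1
    · linear_combination h
    · ring
  · simp [block12, Matrix.det_fin_three]
    linear_combination h

theorem block13_mem {a b : ℂ} (h : a * conj a + b * conj b = 1) :
    block13 a b ∈ Matrix.specialUnitaryGroup (Fin 3) ℂ := by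
  rw [mem_SU3_iff]
  constructor
  · rw [conjTranspose_block13, block13_mul, ← block13_one]
    congr 1
    · linear_combination h
    · ring
  · simp [block13, Matrix.det_fin_three]
    linear_combination h

/-! ### One-parameter subgroups of the control directions -/

theorem hasDerivAt_exp_ofReal_mul (c : ℂ) (s : ℝ) :
    HasDerivAt (fun s : ℝ => Complex.exp (s * c)) (Complex.exp (s * c) * c) s := by
  simpa using ((Complex.ofRealCLM.hasDerivAt (x := s)).mul_const c).cexp

theorem hasDerivAt_cos_ofReal (s : ℝ) :
    HasDerivAt (fun s : ℝ => Complex.cos s) (-Complex.sin s) s := by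
  simpa using (Complex.hasDerivAt_cos s).comp_ofReal

theorem hasDerivAt_I_mul_sin_ofReal (s : ℝ) :
    HasDerivAt (fun s : ℝ => Complex.I * Complex.sin s) (Complex.I * Complex.cos s) s := by
  simpa using ((Complex.hasDerivAt_sin s).comp_ofReal).const_mul Complex.I

theorem conj_exp_ofReal_mul_I (s : ℝ) :
    conj (Complex.exp (s * Complex.I)) = Complex.exp (s * -Complex.I) := by
  rw [← Complex.exp_conj]; simp

theorem exp_ofReal_mul_I_mul_conj (s : ℝ) :
    Complex.exp (s * Complex.I) * conj (Complex.exp (s * Complex.I)) = 1 := by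
  rw [conj_exp_ofReal_mul_I, ← Complex.exp_add]; simp

theorem cos_mul_conj_add_I_mul_sin_mul_conj (s : ℝ) :
    Complex.cos s * conj (Complex.cos s) +
      Complex.I * Complex.sin s * conj (Complex.I * Complex.sin s) = 1 := by
  simp only [map_mul, ← Complex.cos_conj, ← Complex.sin_conj, Complex.conj_I, Complex.conj_ofReal]
  linear_combination Complex.sin_sq_add_cos_sq s - Complex.sin s ^ 2 * Complex.I_mul_I

theorem phase12_mem_reachableSubgroup (s : ℝ)
    (h : block12 (Complex.exp (s * Complex.I)) 0 ∈ Matrix.specialUnitaryGroup (Fin 3) ℂ) :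
    (⟨_, h⟩ : SU3) ∈ reachableSubgroup := by
  refine mem_reachableSubgroup_of_hasDerivAt (v := !₂[0, 1, 0, 0])
    (γ := fun s : ℝ => block12 (Complex.exp (s * Complex.I)) 0) ?_
    (fun s => block12_mem (by simpa using exp_ofReal_mul_I_mul_conj s)) (fun s => ?_)
    (fun s i j => ?_) s
  · simp [block12_one]
  · rw [conjTranspose_block12, conj_exp_ofReal_mul_I]; simp
  · fin_cases i <;> fin_cases j <;>
      simp [block12, conj_exp_ofReal_mul_I, generator, Z3, Matrix.mul_apply, Fin.sum_univ_three,
        hasDerivAt_const]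
    · exact hasDerivAt_exp_ofReal_mul _ s
    · simpa using hasDerivAt_exp_ofReal_mul (-Complex.I) s

theorem phase13_mem_reachableSubgroup (s : ℝ)
    (h : block13 (Complex.exp (s * Complex.I)) 0 ∈ Matrix.specialUnitaryGroup (Fin 3) ℂ) :
    (⟨_, h⟩ : SU3) ∈ reachableSubgroup := by
  have h3 : (Real.sqrt 3 : ℂ) ≠ 0 := by
    exact_mod_cast (Real.sqrt_pos.2 (by norm_num : (0 : ℝ) < 3)).ne'
  -- (Z₃ + √3 Z₈)/2 = diag(1, 0, -1) plays on coordinates 1, 3 the role of Z₃ on 1, 2.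
  have hgen : generator !₂[0, 1 / 2, 0, Real.sqrt 3 / 2] =
      !![Complex.I, 0, 0; 0, 0, 0; 0, 0, -Complex.I] := by
    ext i j
    fin_cases i <;> fin_cases j <;> simp [generator, Z1, Z3, Z4, Z8] <;> field_simp <;> ring
  refine mem_reachableSubgroup_of_hasDerivAt (v := !₂[0, 1 / 2, 0, Real.sqrt 3 / 2])
    (γ := fun s : ℝ => block13 (Complex.exp (s * Complex.I)) 0) ?_
    (fun s => block13_mem (by simpa using exp_ofReal_mul_I_mul_conj s)) (fun s => ?_)
    (fun s i j => ?_) s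
  · simp [block13_one]
  · rw [conjTranspose_block13, conj_exp_ofReal_mul_I]; simp
  · rw [hgen]
    fin_cases i <;> fin_cases j <;>
      simp [block13, conj_exp_ofReal_mul_I, Matrix.mul_apply, Fin.sum_univ_three,
        hasDerivAt_const]
    · exact hasDerivAt_exp_ofReal_mul _ s
    · simpa using hasDerivAt_exp_ofReal_mul (-Complex.I) s

/-- This is exp(isZ₁), as Z₁ squares to the identity on coordinates 1, 2. -/
theorem rot12_mem_reachableSubgroup (s : ℝ)
    (h : block12 (Complex.cos s) (Complex.I * Complex.sin s) ∈
      Matrix.specialUnitaryGroup (Fin 3) ℂ) :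
    (⟨_, h⟩ : SU3) ∈ reachableSubgroup := by
  refine mem_reachableSubgroup_of_hasDerivAt (v := !₂[1, 0, 0, 0])
    (γ := fun s : ℝ => block12 (Complex.cos s) (Complex.I * Complex.sin s)) ?_
    (fun s => block12_mem (cos_mul_conj_add_I_mul_sin_mul_conj s)) (fun s => ?_)
    (fun s i j => ?_) s
  · simp [block12_one]
  · rw [conjTranspose_block12, ← Complex.cos_conj]; simp
  · have hc := hasDerivAt_cos_ofReal s
    have hs := hasDerivAt_I_mul_sin_ofReal s
    have e : Complex.I * Complex.sin s * Complex.I = -Complex.sin s := by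
      linear_combination Complex.sin s * Complex.I_mul_I
    fin_cases i <;> fin_cases j <;>
      simp [block12, generator, Z1, Matrix.mul_apply, Fin.sum_univ_three, ← Complex.cos_conj,
        ← Complex.sin_conj, hasDerivAt_const, e, hc, mul_comm _ Complex.I, hs]

theorem rot13_mem_reachableSubgroup (s : ℝ)
    (h : block13 (Complex.cos s) (Complex.I * Complex.sin s) ∈
      Matrix.specialUnitaryGroup (Fin 3) ℂ) :
    (⟨_, h⟩ : SU3) ∈ reachableSubgroup := by
  refine mem_reachableSubgroup_of_hasDerivAt (v := !₂[0, 0, 1, 0])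
    (γ := fun s : ℝ => block13 (Complex.cos s) (Complex.I * Complex.sin s)) ?_
    (fun s => block13_mem (cos_mul_conj_add_I_mul_sin_mul_conj s)) (fun s => ?_)
    (fun s i j => ?_) s
  · simp [block13_one]
  · rw [conjTranspose_block13, ← Complex.cos_conj]; simp
  · have hc := hasDerivAt_cos_ofReal s
    have hs := hasDerivAt_I_mul_sin_ofReal s
    have e : Complex.I * Complex.sin s * Complex.I = -Complex.sin s := by
      linear_combination Complex.sin s * Complex.I_mul_I
    fin_cases i <;> fin_cases j <;>
      simp [block13, generator, Z4, Matrix.mul_apply, Fin.sum_univ_three, ← Complex.cos_conj,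
        ← Complex.sin_conj, hasDerivAt_const, e, hc, mul_comm _ Complex.I, hs]

/-- Euler angles for the pairs `(a, b)` with `|a|² + |b|² = 1`. -/
theorem exists_euler_angles {a b : ℂ} (h : a * conj a + b * conj b = 1) :
    ∃ p q θ : ℝ,
      a = Complex.exp (p * Complex.I) * Complex.cos θ * Complex.exp (q * Complex.I) ∧
      b = conj (Complex.exp (p * Complex.I)) * (Complex.I * Complex.sin θ) *
        Complex.exp (q * Complex.I) := by
  have hn : ‖a‖ ^ 2 + ‖b‖ ^ 2 = 1 := by
    rw [Complex.mul_conj, Complex.mul_conj, Complex.normSq_eq_norm_sq,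
      Complex.normSq_eq_norm_sq] at h
    exact_mod_cast h
  -- Removes the factor i of the rotation; the phases then require p + q = arg a and q - p = arg c.
  set c : ℂ := -Complex.I * b with hc
  have hcn : ‖c‖ = ‖b‖ := by simp [hc]
  have hbc : b = Complex.I * c := by rw [hc]; linear_combination b * Complex.I_mul_I
  have hcos : Complex.cos (Real.arccos ‖a‖) = ‖a‖ := by
    rw [← Complex.ofReal_cos, Real.cos_arccos (by linarith [norm_nonneg a])
      (by nlinarith [sq_nonneg ‖b‖, norm_nonneg a])]
  have hsin : Complex.sin (Real.arccos ‖a‖) = ‖b‖ := by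
    rw [← Complex.ofReal_sin, Real.sin_arccos, show 1 - ‖a‖ ^ 2 = ‖b‖ ^ 2 by linarith,
      Real.sqrt_sq (norm_nonneg b)]
  refine ⟨(a.arg - c.arg) / 2, (a.arg + c.arg) / 2, Real.arccos ‖a‖, ?_, ?_⟩
  · rw [hcos, mul_right_comm, ← Complex.exp_add, mul_comm]
    conv_lhs => rw [← Complex.norm_mul_exp_arg_mul_I a]
    congr 2
    push_cast
    ring
  · rw [hsin, ← hcn, conj_exp_ofReal_mul_I, mul_right_comm, ← Complex.exp_add, hbc]
    conv_lhs => rw [← Complex.norm_mul_exp_arg_mul_I c, ← mul_assoc, mul_comm]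
    congr 2
    push_cast
    ring

theorem block12_mem_reachableSubgroup {a b : ℂ} (h : a * conj a + b * conj b = 1) :
    (⟨block12 a b, block12_mem h⟩ : SU3) ∈ reachableSubgroup := by
  obtain ⟨p, q, θ, ha, hb⟩ := exists_euler_angles h
  have hph : ∀ s : ℝ,
      block12 (Complex.exp (s * Complex.I)) 0 ∈ Matrix.specialUnitaryGroup (Fin 3) ℂ :=
    fun s => block12_mem (by simpa using exp_ofReal_mul_I_mul_conj s)
  have hr := block12_mem (cos_mul_conj_add_I_mul_sin_mul_conj θ)
  have := mul_mem (mul_mem (phase12_mem_reachableSubgroup p (hph p))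
    (rot12_mem_reachableSubgroup θ hr)) (phase12_mem_reachableSubgroup q (hph q))
  convert this using 1
  apply Subtype.ext
  simp only [Submonoid.mk_mul_mk, block12_mul]
  rw [ha, hb]
  congr 1 <;> simp

theorem block13_mem_reachableSubgroup {a b : ℂ} (h : a * conj a + b * conj b = 1) :
    (⟨block13 a b, block13_mem h⟩ : SU3) ∈ reachableSubgroup := by
  obtain ⟨p, q, θ, ha, hb⟩ := exists_euler_angles h
  have hph : ∀ s : ℝ,
      block13 (Complex.exp (s * Complex.I)) 0 ∈ Matrix.specialUnitaryGroup (Fin 3) ℂ :=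
    fun s => block13_mem (by simpa using exp_ofReal_mul_I_mul_conj s)
  have hr := block13_mem (cos_mul_conj_add_I_mul_sin_mul_conj θ)
  have := mul_mem (mul_mem (phase13_mem_reachableSubgroup p (hph p))
    (rot13_mem_reachableSubgroup θ hr)) (phase13_mem_reachableSubgroup q (hph q))
  convert this using 1
  apply Subtype.ext
  simp only [Submonoid.mk_mul_mk, block13_mul]
  rw [ha, hb]
  congr 1 <;> simp

/-- A unitary rotation that takes `(a, b)` to `(√(|a|² + |b|²), 0)`. -/
theorem exists_givens (a b : ℂ) : ∃ α β : ℂ, α * conj α + β * conj β = 1 ∧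
    α * a - conj β * b = Real.sqrt (‖a‖ ^ 2 + ‖b‖ ^ 2) ∧ β * a + conj α * b = 0 := by
  have hab : a * conj a + b * conj b = (Real.sqrt (‖a‖ ^ 2 + ‖b‖ ^ 2) : ℂ) ^ 2 := by
    rw [← Complex.ofReal_pow, Real.sq_sqrt (by positivity), Complex.mul_conj, Complex.mul_conj,
      Complex.normSq_eq_norm_sq, Complex.normSq_eq_norm_sq]
    push_cast
    rfl
  set r := Real.sqrt (‖a‖ ^ 2 + ‖b‖ ^ 2) with hr
  by_cases h0 : r = 0
  · have h1 : ‖a‖ ^ 2 + ‖b‖ ^ 2 = 0 := (Real.sqrt_eq_zero (by positivity)).1 h0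
    have ha : a = 0 := by
      rw [← norm_eq_zero]; nlinarith [sq_nonneg ‖a‖, sq_nonneg ‖b‖]
    have hb : b = 0 := by
      rw [← norm_eq_zero]; nlinarith [sq_nonneg ‖a‖, sq_nonneg ‖b‖]
    exact ⟨1, 0, by simp, by simp [ha, h0], by simp [hb]⟩
  · have h0' : (r : ℂ) ≠ 0 := by exact_mod_cast h0
    -- The rotation has first row (ā, b̄)/r, the normalized conjugate of the given vector.
    refine ⟨conj a / r, -b / r, ?_, ?_, ?_⟩
    · simp only [map_div₀, map_neg, Complex.conj_conj, Complex.conj_ofReal]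
      field_simp
      linear_combination hab
    · simp only [map_div₀, map_neg, Complex.conj_ofReal]
      field_simp
      linear_combination hab
    · simp only [map_div₀, Complex.conj_conj, Complex.conj_ofReal]
      field_simp
      ring

/-! ### Factorization of SU(3) into blocks -/

theorem mul_conjTranspose_SU3 (g : SU3) : (g : Mat3) * (g : Mat3).conjTranspose = 1 :=
  ((mem_SU3_iff _).1 g.2).1

theorem conjTranspose_mul_SU3 (g : SU3) : (g : Mat3).conjTranspose * (g : Mat3) = 1 :=
  mul_eq_one_comm.1 (mul_conjTranspose_SU3 g)

/-- Both are inverses of g, as det g = 1. Comparing entries expresses conjugated entries by 2 × 2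
minors. -/
theorem conjTranspose_eq_adjugate_SU3 (g : SU3) :
    (g : Mat3).conjTranspose = (g : Mat3).adjugate := by
  have h : (g : Mat3) * (g : Mat3).adjugate = 1 := by
    rw [Matrix.mul_adjugate, ((mem_SU3_iff _).1 g.2).2, one_smul]
  rw [← mul_one (g : Mat3).conjTranspose, ← h, ← mul_assoc, conjTranspose_mul_SU3, one_mul]

theorem sum_norm_sq_row_SU3 (g : SU3) (i : Fin 3) :
    ‖(g : Mat3) i 0‖ ^ 2 + ‖(g : Mat3) i 1‖ ^ 2 + ‖(g : Mat3) i 2‖ ^ 2 = 1 := by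
  have h := congrFun (congrFun (mul_conjTranspose_SU3 g) i) i
  simp only [Matrix.mul_apply, Fin.sum_univ_three, Matrix.conjTranspose_apply, Complex.star_def,
    Complex.mul_conj, Complex.normSq_eq_norm_sq, Matrix.one_apply_eq] at h
  exact_mod_cast h

theorem sum_norm_sq_col_SU3 (g : SU3) (i : Fin 3) :
    ‖(g : Mat3) 0 i‖ ^ 2 + ‖(g : Mat3) 1 i‖ ^ 2 + ‖(g : Mat3) 2 i‖ ^ 2 = 1 := by
  have h := congrFun (congrFun (conjTranspose_mul_SU3 g) i) i
  simp only [Matrix.mul_apply, Fin.sum_univ_three, Matrix.conjTranspose_apply, Complex.star_def,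
    ← Complex.normSq_eq_conj_mul_self, Complex.normSq_eq_norm_sq, Matrix.one_apply_eq] at h
  exact_mod_cast h

/-- The stabilizer of the first basis vector is reachable. -/
theorem mem_reachableSubgroup_of_apply_zero_zero {g : SU3} (h00 : (g : Mat3) 0 0 = 1) :
    g ∈ reachableSubgroup := by
  have hz : ∀ x y : ℂ, ‖(g : Mat3) 0 0‖ ^ 2 + ‖x‖ ^ 2 + ‖y‖ ^ 2 = 1 → x = 0 ∧ y = 0 := by
    intro x y h
    rw [h00, norm_one] at h
    constructor <;> rw [← norm_eq_zero] <;> nlinarith [sq_nonneg ‖x‖, sq_nonneg ‖y‖]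
  obtain ⟨h01, h02⟩ := hz _ _ (sum_norm_sq_row_SU3 g 0)
  obtain ⟨h10, h20⟩ := hz _ _ (sum_norm_sq_col_SU3 g 0)
  have hadj := conjTranspose_eq_adjugate_SU3 g
  set p := (g : Mat3) 1 1 with hp
  set q := (g : Mat3) 2 1 with hq
  have h22 : (g : Mat3) 2 2 = conj p := by
    have := congrFun (congrFun hadj 1) 1
    simp [Matrix.adjugate_fin_three, h00, h02] at this
    rw [hp, this]
  have h12 : (g : Mat3) 1 2 = -conj q := by
    have := congrFun (congrFun hadj 1) 2
    simp [Matrix.adjugate_fin_three, h00, h02] at this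
    rw [hq, this, neg_neg]
  have hpq : conj p * conj (conj p) + Complex.I * conj q * conj (Complex.I * conj q) = 1 := by
    have h := congrFun (congrFun (conjTranspose_mul_SU3 g) 1) 1
    simp only [Matrix.mul_apply, Fin.sum_univ_three, Matrix.conjTranspose_apply,
      Complex.star_def, h01, ← hp, ← hq, Matrix.one_apply_eq, mul_zero, zero_add] at h
    simp only [map_mul, Complex.conj_conj, Complex.conj_I]
    linear_combination h - q * conj q * Complex.I_mul_I
  -- `block13 0 i` swaps coordinates 1 and 3 up to factors i. Conjugation by it moves a block from
  -- coordinates 1, 2 to 2, 3; the i in `hpq` compensates these factors.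
  have hw : (0 : ℂ) * conj 0 + Complex.I * conj Complex.I = 1 := by simp
  have hw' := block13_mem_reachableSubgroup hw
  have key := mul_mem (mul_mem (inv_mem hw') (block12_mem_reachableSubgroup hpq)) hw'
  convert key using 1
  apply Subtype.ext
  rw [Submonoid.coe_mul, Submonoid.coe_mul, coe_inv_SU3, conjTranspose_block13]
  ext i j
  fin_cases i <;> fin_cases j <;>
    simp [block12, block13, Matrix.mul_apply, Fin.sum_univ_three, h00, h01, h02, h10, h20, h12,
      h22, ← hp, ← hq]
  · linear_combination -conj q * Complex.I_mul_I
  · linear_combination q * Complex.I_mul_I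
  · linear_combination conj p * Complex.I_mul_I

/-- Elimination in the first column: a block on 1, 2 turns its top two entries into (r, 0), then a
block on 1, 3 turns (r, g₃₁) into (1, 0), since the column has norm 1. -/
theorem reachableSubgroup_eq_top : reachableSubgroup = ⊤ := by
  refine eq_top_iff.2 fun g _ => ?_
  obtain ⟨α, β, h1, h2, h3⟩ := exists_givens ((g : Mat3) 0 0) ((g : Mat3) 1 0)
  set r := Real.sqrt (‖(g : Mat3) 0 0‖ ^ 2 + ‖(g : Mat3) 1 0‖ ^ 2) with hr
  obtain ⟨α', β', h1', h2', -⟩ := exists_givens (r : ℂ) ((g : Mat3) 2 0)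
  have hone : Real.sqrt (‖(r : ℂ)‖ ^ 2 + ‖(g : Mat3) 2 0‖ ^ 2) = 1 := by
    rw [Complex.norm_real, Real.norm_eq_abs, sq_abs, hr, Real.sq_sqrt (by positivity),
      sum_norm_sq_col_SU3, Real.sqrt_one]
  rw [hone] at h2'
  have hA := block12_mem_reachableSubgroup h1
  have hB := block13_mem_reachableSubgroup h1'
  rw [← Subgroup.mul_mem_cancel_left _ hA, ← Subgroup.mul_mem_cancel_left _ hB]
  apply mem_reachableSubgroup_of_apply_zero_zero
  have e0 : (block12 α β * (g : Mat3)) 0 0 = r := by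
    rw [← h2]; simp [block12, Matrix.mul_apply, Fin.sum_univ_three, sub_eq_add_neg]
  have e2 : (block12 α β * (g : Mat3)) 2 0 = (g : Mat3) 2 0 := by
    simp [block12, Matrix.mul_apply, Fin.sum_univ_three]
  have e : (block13 α' β' * (block12 α β * (g : Mat3))) 0 0 =
      α' * (block12 α β * (g : Mat3)) 0 0 - conj β' * (block12 α β * (g : Mat3)) 2 0 := by
    rw [Matrix.mul_apply]
    simp [block13, Fin.sum_univ_three, sub_eq_add_neg]
  rw [e0, e2, h2'] at e
  simpa using e

theorem reachable (g : SU3) : Reachable g :=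
  (reachableSubgroup_eq_top ▸ Subgroup.mem_top g : g ∈ reachableSubgroup).1

/-! ### Global controllability -/

theorem controllableOnCosets : ControllableOnCosets := by
  intro x₁ x₂ g _ T hT
  obtain ⟨h, rfl⟩ := QuotientGroup.mk_surjective x₂
  obtain ⟨u, hu, x, hx, hx0, hxT⟩ := (reachable (g⁻¹ * h)).exists_isSolution g hT
  exact ⟨u, hu, x, hx, hx0, by rw [hxT, mul_inv_cancel_left]⟩

theorem controllableOnSymm : ControllableOnSymm := by
  intro A₁ h₁ A₂ h₂ T hT
  obtain ⟨g, rfl⟩ := exists_transpose_mul_self_eq h₁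
  obtain ⟨h, rfl⟩ := exists_transpose_mul_self_eq h₂
  obtain ⟨u, hu, A, hA, hA0, hAT⟩ := (reachable (g⁻¹ * h)).exists_isSymmSolution g hT
  rw [mul_inv_cancel_left] at hAT
  exact ⟨u, hu, A, hA, hA0, hAT⟩

end COEControl

end

open COEControl in
theorem mainTheorem5 :
    ⁅⁅Z1, Z3⁆, Z4⁆ = (2 : ℂ) • Z6 ∧
    LTS {Z1, Z3, Z4, Z8} = Submodule.span ℝ {Z1, Z3, Z4, Z6, Z8} ∧
    LTS {Complex.I • Z1, Complex.I • Z3, Complex.I • Z4, Complex.I • Z8} =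
      Submodule.span ℝ {Complex.I • Z1, Complex.I • Z3, Complex.I • Z4, Complex.I • Z6,
        Complex.I • Z8} ∧
    LTS {Complex.I • Z1, Complex.I • Z3, Complex.I • Z4, Complex.I • Z8} = su3ModSo3 ∧
    ControllableOnCosets ∧
    ControllableOnSymm := by
  exact ⟨bracket_Z1_Z3_Z4, LTS_Z, LTS_mulI_Z.trans span_mulI_Z.symm, LTS_mulI_Z,
    controllableOnCosets, controllableOnSymm⟩
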